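/- Let $(V,E)$ be an infinite, locally finite, connected graph. Let each edge $xy\in E$ carry a resistance $R_{xy}\in[0,\infty)$, an inductance $L_{xy}\in[0,\infty)$ and a capacitance $C_{xy}\in(0,\infty]$, put $D_{xy}=1/C_{xy}\in[0,\infty)$, and assume $R_{xy}+L_{xy}+D_{xy}>0$. For $\lambda\in\mathbb{C}\setminus\{0\}$ let $z_{xy}^{(\lambda)}=R_{xy}+L_{xy}\lambda+D_{xy}/\lambda$ and $\rho_{xy}^{(\lambda)}=1/z_{xy}^{(\lambda)}$ on edges, $\rho_{xy}^{(\lambda)}=0$ if $xy\notin E$. Let $a\in V$ and let $B\subset V$ be a possibly empty set with $a\notin B$. For $n\ge 1$ let $V_n=\{x: \operatorname{dist}(a,x)\le n\}$ for the graph distance, and $B_n=(B\cap V_n)\cup\{x:\operatorname{dist}(a,x)=n\}$. For $\lambda\neq0$ with $z^{(\lambda)}_{xy}\ne0$ on all edges, the effective admittance $\mathcal{P}_n(\lambda)\in\mathbb{C}\cup\{\infty\}$ of the finite network on $V_n$ (with all edges of $E$ between vertices of $V_n$) is $$\mathcal{P}_n(\lambda)=\sum_{x\in V_n}(1-v(x))\,\rho^{(\lambda)}_{xa},$$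 where $v:V_n\to\mathbb{C}$ is any solution of the Dirichlet problem $\sum_{y\in V_n}(v(y)-v(x))\rho^{(\lambda)}_{xy}=0$ for $x\in V_n\setminus(B_n\cup\{a\})$, $v=0$ on $B_n$, $v(a)=1$ (the value does not depend on the choice of $v$), and $\mathcal{P}_n(\lambda)=\infty$ if there is no solution. Assume that $R_{xy}=0$ for all $xy\in E$, and set $$S_D=\sup_{xy\in E}\frac{D_{xy}}{L_{xy}},\qquad S_D^*=\inf_{xy\in E}\frac{D_{xy}}{L_{xy}},\qquad S=\sup_{xy\in E}\frac1{C_{xy}L_{xy}}$$ in $[0,\infty]$, a quotient with $L_{xy}=0$ being $+\infty$; neither $S_D<\infty$ nor $S_D^*>0$ is assumed. Let $$J^*=\left[i\sqrt{S_D^*},\,i\sqrt{S_D}\right]\cup\left[-i\sqrt{S_D},\,-i\sqrt{S_D^*}\right]\cup\{0\},$$ where $[i\alpha,i\beta]=\{iy: y\in\mathbb{R},\ \alpha\le y\le\beta\}$ for $\alpha,\beta\in[-\infty,\infty]$. Then $\mathbb{C}\setminus J^*$ is open, and for every $\lambda\in\mathbb{C}\setminus J^*$ all $z_{xy}^{(\lambda)}$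 are non-zero and the limit $\mathcal{P}(\lambda)=\lim_{n\to\infty}\mathcal{P}_n(\lambda)$ exists in $\mathbb{C}$; the function $\mathcal{P}$ is holomorphic in $\mathbb{C}\setminus J^*$. In particular, the same holds in the open set $\mathbb{C}\setminus[-i\sqrt S,\,i\sqrt S]$. -/

import Mathlib

open scoped NNReal ENNReal Topology

noncomputable section

/-- A graph whose edges carry a resistance `R ∈ [0, ∞)`, an inductance `L ∈ [0, ∞)` and a
capacitance `C ∈ (0, ∞]`, not all three trivial: `R + L + 1 / C > 0` on every edge.
The values of `R`, `L`, `C` on pairs that are not edges are never used. -/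
structure RLCGraph (V : Type*) where
  graph : SimpleGraph V
  R : Sym2 V → ℝ≥0
  L : Sym2 V → ℝ≥0
  C : Sym2 V → ℝ≥0∞
  C_ne_zero : ∀ e ∈ graph.edgeSet, C e ≠ 0
  pos : ∀ e ∈ graph.edgeSet, 0 < (R e : ℝ≥0∞) + L e + (C e)⁻¹

namespace RLCGraph

variable {V : Type*}

/-- The inverse capacity `D = 1 / C`, a finite number on every edge. -/
def D (N : RLCGraph V) (e : Sym2 V) : ℝ≥0 := ((N.C e)⁻¹).toNNReal

/-- The impedance `z = R + L s + D / s` of an edge, a function of the complex parameter `s`. -/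
def impedance (N : RLCGraph V) (s : ℂ) (e : Sym2 V) : ℂ :=
  ((N.R e : ℝ) : ℂ) + ((N.L e : ℝ) : ℂ) * s + ((N.D e : ℝ) : ℂ) / s

open Classical in
/-- The admittance `ρ = 1 / z` of an edge, extended by `0` to the pairs that are not edges. -/
def admittance (N : RLCGraph V) (s : ℂ) (x y : V) : ℂ :=
  if N.graph.Adj x y then 1 / N.impedance s s(x, y) else 0

/-- The set `Λ` of the parameters for which the admittance of every edge is a finite non-zero
complex number. -/
def regularSet (N : RLCGraph V) : Set ℂ :=
  {s | s ≠ 0 ∧ ∀ e ∈ N.graph.edgeSet, N.impedance s e ≠ 0}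

/-- The physical Laplacian. The sum has finitely many non-zero terms in a locally finite graph. -/
def laplacian (N : RLCGraph V) (s : ℂ) (f : V → ℂ) (x : V) : ℂ :=
  ∑ᶠ y, (f y - f x) * N.admittance s x y

/-- `v` solves the Dirichlet problem with source `a` and ground `B`. -/
structure IsVoltage (N : RLCGraph V) (a : V) (B : Set V) (s : ℂ) (v : V → ℂ) : Prop where
  harmonic : ∀ x, x ∉ B → x ≠ a → N.laplacian s v x = 0
  ground : ∀ x ∈ B, v x = 0
  source : v a = 1

open Classical in
/-- The effective admittance of the finite network with source `a` and ground `B`: the total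
current through `a` for a solution of the Dirichlet problem (its value does not depend on the
solution), and `∞` if there is no solution. It is meaningful for `s ∈ N.regularSet`. -/
def effAdmittance (N : RLCGraph V) (a : V) (B : Set V) (s : ℂ) : OnePoint ℂ :=
  if h : ∃ v, N.IsVoltage a B s v then
    ((∑ᶠ x, (1 - h.choose x) * N.admittance s x a : ℂ) : OnePoint ℂ)
  else OnePoint.infty

/-- The subgraph on a set `W` of vertices, with all the edges that have both endpoints in `W`
and the restricted weights. -/
def restrict (N : RLCGraph V) (W : Set V) : RLCGraph W where
  graph := N.graph.induce W
  R e := N.R (e.map Subtype.val)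
  L e := N.L (e.map Subtype.val)
  C e := N.C (e.map Subtype.val)
  C_ne_zero e := by
    induction e using Sym2.ind with
    | _ x y => exact fun h => N.C_ne_zero s(x.1, y.1) h
  pos e := by
    induction e using Sym2.ind with
    | _ x y => exact fun h => N.pos s(x.1, y.1) h

/-- `V_n`, the ball of radius `n` about `a` in the graph distance. -/
def ball (N : RLCGraph V) (a : V) (n : ℕ) : Set V := {x | N.graph.dist a x ≤ n}

/-- The effective admittance `P_n` of the finite network on `V_n` with source `a` and ground
`B_n = (B ∩ V_n) ∪ ∂V_n`, where `∂V_n` is the sphere of radius `n` about `a`.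
(For `n = 0` the source belongs to the ground, and the value is `∞`.) -/
def partialAdmittance (N : RLCGraph V) (a : V) (B : Set V) (n : ℕ) (s : ℂ) : OnePoint ℂ :=
  (N.restrict (N.ball a n)).effAdmittance ⟨a, by simp [ball]⟩
    {x | x.1 ∈ B ∨ N.graph.dist a x.1 = n} s

/-- The infinite network with source `a` and ground `B` (and at infinity) has the effective
admittance `p ∈ ℂ` at the parameter `s`: every `P_n(s)` is defined and `P_n(s) → p`. -/
def HasEffAdmittance (N : RLCGraph V) (a : V) (B : Set V) (s p : ℂ) : Prop :=
  s ∈ N.regularSet ∧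
    Filter.Tendsto (fun n => N.partialAdmittance a B n s) Filter.atTop (𝓝 (p : OnePoint ℂ))

/-- `S_D = sup D / L` over the edges, in `[0, ∞]`; here `D / 0 = ∞` for `D > 0`. -/
def supD (N : RLCGraph V) : ℝ≥0∞ := ⨆ e ∈ N.graph.edgeSet, (N.D e : ℝ≥0∞) / N.L e

/-- `S_D^* = inf D / L` over the edges, in `[0, ∞]`. -/
def infD (N : RLCGraph V) : ℝ≥0∞ := ⨅ e ∈ N.graph.edgeSet, (N.D e : ℝ≥0∞) / N.L e

/-- `S = sup 1 / (C L)` over the edges, in `[0, ∞]`. -/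
def supCL (N : RLCGraph V) : ℝ≥0∞ := ⨆ e ∈ N.graph.edgeSet, 1 / (N.C e * N.L e)

/-- The square root on `[0, ∞]`, as an extended real number. -/
def sqrtE (t : ℝ≥0∞) : EReal := ((t ^ (1 / 2 : ℝ) : ℝ≥0∞) : EReal)

/-- The interval `[i α, i β]` of the imaginary axis, for extended real numbers `α`, `β`. -/
def imInterval (α β : EReal) : Set ℂ :=
  {s | ∃ y : ℝ, α ≤ (y : EReal) ∧ (y : EReal) ≤ β ∧ s = Complex.I * (y : ℂ)}

/-- `J^* = [i √S_D^*, i √S_D] ∪ [-i √S_D, -i √S_D^*] ∪ {0}`. -/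
def exceptionalSet (N : RLCGraph V) : Set ℂ :=
  imInterval (sqrtE N.infD) (sqrtE N.supD) ∪ imInterval (-sqrtE N.supD) (-sqrtE N.infD) ∪ {0}

end RLCGraph

end

/-! Without resistors an edge has impedance `(L + D) (t s² + 1 - t) / s`, where `t = L / (L + D)`
lies in `[0, 1]`. Weighting potential differences by `(L + D)^(-1/2)` absorbs the possibly unbounded
factor `L + D`, and the admittances become a diagonal operator `A_s` on `ℓ²` of the oriented edges
with entries `s / (t s² + 1 - t)`. Let `g` be the weighted gradient of the indicator of `a`, and let
`K_n` be spanned by those of the free vertices of `V_n`. The Dirichlet problem then asks for `u ∈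
K_n` with `A_s (g + u) ⟂ K_n`, and `P_n(s) = ⟨g, A_s (g + u)⟩ / 2`, since each edge is counted in
both orientations (`partialAdmittance_eq`).

Off `J^*` the numbers `t s² + 1 - t` lie in a half plane at positive distance from `0`: if `Re s ≠
0`, the whole segment from `1` to `s²` misses `0`; on the imaginary axis the bounds on `D / L` keep
`t` away from the zero (`RLCGraph.isSectorial`). Hence `A_s` is bounded and coercive
(`IsSectorial.coercive`). Lax–Milgram solves the variational problem on each `K_n` and on the
closure of their union, and as `K_n` increases, Céa's lemma gives convergence
(`IsGalerkinSolution.tendsto`). The limit is built from `A_s` by operator inversion, so its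
holomorphy is direct (`differentiableAt_galerkinSolution`). -/

/-! ### Galerkin approximation for coercive operators -/

section Galerkin

variable {H : Type*} [NormedAddCommGroup H] [InnerProductSpace ℂ H]

/-- `u ∈ K` solves the variational problem `A (g + u) ⟂ K`. -/
structure IsGalerkinSolution (A : H →L[ℂ] H) (g : H) (K : Submodule ℂ H) (u : H) : Prop where
  mem : u ∈ K
  orthogonal : ∀ φ ∈ K, inner ℂ φ (A (g + u)) = 0

/-- The compression of an operator to a subspace. -/
noncomputable def compression (K : Submodule ℂ H) [K.HasOrthogonalProjection] (A : H →L[ℂ] H) :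
    K →L[ℂ] K :=
  K.orthogonalProjectionOnto ∘L A ∘L K.subtypeL

/-- The solution of the variational problem `A (g + u) ⟂ K`. -/
noncomputable def galerkinSolution (K : Submodule ℂ H) [K.HasOrthogonalProjection] (g : H)
    (A : H →L[ℂ] H) : H :=
  -(Ring.inverse (compression K A) (K.orthogonalProjectionOnto (A g)) : K)

variable {A : H →L[ℂ] H} {g : H} {c : ℝ}

/-- Lax–Milgram: for `x ∈ K` the projection does not change `⟨x, A x⟩`, so the compression inherits
the coercivity of `A`. -/
theorem isUnit_compression (K : Submodule ℂ H) [CompleteSpace K] (hc : 0 < c)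
    (hA : ∀ x, c * ‖x‖ ^ 2 ≤ ‖inner ℂ x (A x)‖) : IsUnit (compression K A) := by
  refine ContinuousLinearMap.isUnit_of_forall_le_norm_inner_map _ (c := ⟨c, hc.le⟩) hc ?_
  intro x
  have h : inner ℂ (compression K A x) x = inner ℂ (A x) (x : H) := by
    simp only [compression, ContinuousLinearMap.comp_apply, Submodule.subtypeL_apply]
    exact K.inner_orthogonalProjectionOnto_eq_of_mem_right x (A x)
  rw [h, norm_inner_symm, mul_comm]
  exact hA x

theorem isGalerkinSolution_galerkinSolution (K : Submodule ℂ H) [CompleteSpace K] (hc : 0 < c)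
    (hA : ∀ x, c * ‖x‖ ^ 2 ≤ ‖inner ℂ x (A x)‖) :
    IsGalerkinSolution A g K (galerkinSolution K g A) := by
  set p := K.orthogonalProjectionOnto (A g)
  set w := Ring.inverse (compression K A) p with hw
  have hu : galerkinSolution K g A = -(w : H) := rfl
  refine ⟨hu ▸ K.neg_mem w.2, fun φ hφ => ?_⟩
  have h : compression K A w = p := by
    have := congrArg (fun T : K →L[ℂ] K => T p)
      (Ring.mul_inverse_cancel _ (isUnit_compression K hc hA))
    simpa using this
  have h' := congrArg (fun q => inner ℂ (⟨φ, hφ⟩ : K) q) h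
  simp only [compression, ContinuousLinearMap.comp_apply, Submodule.subtypeL_apply, p] at h'
  rw [K.inner_orthogonalProjectionOnto_eq_of_mem_left,
    K.inner_orthogonalProjectionOnto_eq_of_mem_left] at h'
  rw [hu, map_add, map_neg, inner_add_right, inner_neg_right, h', add_neg_cancel]

/-- Quasi-optimality of Galerkin approximations. -/
theorem IsGalerkinSolution.norm_sub_le {K K' : Submodule ℂ H} {u u' φ : H}
    (hA : ∀ x, c * ‖x‖ ^ 2 ≤ ‖inner ℂ x (A x)‖)
    (hu : IsGalerkinSolution A g K u) (hu' : IsGalerkinSolution A g K' u') (hK : K' ≤ K)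
    (hφ : φ ∈ K') : c * ‖u' - u‖ ≤ ‖A‖ * ‖φ - u‖ := by
  have key : ∀ ψ ∈ K', inner ℂ ψ (A (u' - u)) = 0 := fun ψ hψ => by
    have : u' - u = (g + u') - (g + u) := by abel
    rw [this, map_sub, inner_sub_right, hu'.orthogonal ψ hψ, hu.orthogonal ψ (hK hψ), sub_zero]
  -- Galerkin orthogonality: the error `A (u' - u)` annihilates `K'`, so `u'` may be exchanged for
  -- any competitor `φ ∈ K'`.
  have h1 : inner ℂ (u' - u) (A (u' - u)) = inner ℂ (φ - u) (A (u' - u)) := by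
    rw [inner_sub_left, inner_sub_left, key _ hu'.mem, key _ hφ]
  have h2 : c * ‖u' - u‖ ^ 2 ≤ ‖φ - u‖ * (‖A‖ * ‖u' - u‖) :=
    (hA _).trans <| h1 ▸ (norm_inner_le_norm _ _).trans (by gcongr; exact A.le_opNorm _)
  rcases (norm_nonneg (u' - u)).eq_or_lt with h | h
  · rw [← h]; simp only [mul_zero]; positivity
  · refine le_of_mul_le_mul_right ?_ h
    linarith

theorem IsGalerkinSolution.unique {K : Submodule ℂ H} {u u' : H} (hc : 0 < c)
    (hA : ∀ x, c * ‖x‖ ^ 2 ≤ ‖inner ℂ x (A x)‖)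
    (hu : IsGalerkinSolution A g K u) (hu' : IsGalerkinSolution A g K u') : u' = u := by
  have h := hu.norm_sub_le hA hu' le_rfl hu.mem
  rw [sub_self, norm_zero, mul_zero] at h
  have : ‖u' - u‖ = 0 := le_antisymm (nonpos_of_mul_nonpos_right h hc) (norm_nonneg _)
  exact sub_eq_zero.1 (norm_eq_zero.1 this)

/-- An element of the union of the `K n` close to `u` lies in every late `K n`, and quasi-optimality
makes `v n` as close to `u`, up to the factor `‖A‖ / c`. -/
theorem IsGalerkinSolution.tendsto {K : ℕ → Submodule ℂ H} (hK : Monotone K) {u : H} {v : ℕ → H}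
    (hc : 0 < c) (hA : ∀ x, c * ‖x‖ ^ 2 ≤ ‖inner ℂ x (A x)‖)
    (hu : IsGalerkinSolution A g (⨆ n, K n).topologicalClosure u)
    (hv : ∀ᶠ n in Filter.atTop, IsGalerkinSolution A g (K n) (v n)) :
    Filter.Tendsto v Filter.atTop (𝓝 u) := by
  rw [Metric.tendsto_atTop']
  intro ε hε
  have hmem : u ∈ closure ((⨆ n, K n : Submodule ℂ H) : Set H) := hu.mem
  obtain ⟨φ, hφ, hd⟩ := Metric.mem_closure_iff.1 hmem (c * ε / (‖A‖ + 1)) (by positivity)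
  obtain ⟨n₀, hn₀⟩ := (Submodule.mem_iSup_of_directed _ hK.directed_le).1 hφ
  obtain ⟨n₁, hn₁⟩ := Filter.eventually_atTop.1 hv
  refine ⟨max n₀ n₁, fun n hn => ?_⟩
  have h := hu.norm_sub_le hA (hn₁ n ((le_max_right _ _).trans hn.le))
    ((le_iSup K n).trans (Submodule.le_topologicalClosure _))
    (hK ((le_max_left _ _).trans hn.le) hn₀)
  rw [dist_comm, dist_eq_norm, lt_div_iff₀ (by positivity)] at hd
  rw [dist_eq_norm]
  have : ‖A‖ * ‖φ - u‖ ≤ ‖φ - u‖ * (‖A‖ + 1) := by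
    nlinarith [norm_nonneg (φ - u), norm_nonneg A]
  exact lt_of_mul_lt_mul_left (h.trans_lt (this.trans_lt hd)) hc.le

theorem DifferentiableAt.comp_ringInverse {R : Type*} [NormedRing R] [NormedAlgebra ℂ R]
    [CompleteSpace R] {f : ℂ → R} {s : ℂ} (hf : DifferentiableAt ℂ f s) (h : IsUnit (f s)) :
    DifferentiableAt ℂ (fun s => Ring.inverse (f s)) s :=
  DifferentiableAt.comp (g := Ring.inverse) s (differentiableAt_inverse h) hf

/-- Inversion is differentiable at every unit of the Banach algebra of operators on `K`, so
coercivity is needed only at the point `s` itself. -/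
theorem differentiableAt_galerkinSolution {T : ℂ → H →L[ℂ] H} {s : ℂ} (K : Submodule ℂ H)
    [CompleteSpace K] (hT : DifferentiableAt ℂ T s) (hc : 0 < c)
    (hA : ∀ x, c * ‖x‖ ^ 2 ≤ ‖inner ℂ x (T s x)‖) :
    DifferentiableAt ℂ (fun s => galerkinSolution K g (T s)) s := by
  have h1 : DifferentiableAt ℂ (fun s => compression K (T s)) s := by
    unfold compression
    exact (differentiableAt_const _).clm_comp (hT.clm_comp (differentiableAt_const _))
  have h2 : DifferentiableAt ℂ (fun s => Ring.inverse (compression K (T s))) s := by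
    exact h1.comp_ringInverse (R := K →L[ℂ] K) (isUnit_compression K hc hA)
  have h3 : DifferentiableAt ℂ (fun s => K.orthogonalProjectionOnto (T s g)) s :=
    K.orthogonalProjectionOnto.differentiableAt.comp s
      (hT.clm_apply (differentiableAt_const g))
  exact (K.subtypeL.differentiableAt.comp s (h2.clm_apply h3)).neg

end Galerkin

/-! ### Diagonal operators on `ℓ²` -/

section Diagonal

variable {ι : Type*}

/-- The diagonal operator on `ℓ²` with bounded entries `m`. -/
noncomputable def diagonalOperator (m : ι → ℂ) (hm : ∃ C, ∀ i, ‖m i‖ ≤ C) :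
    lp (fun _ : ι => ℂ) 2 →L[ℂ] lp (fun _ : ι => ℂ) 2 :=
  LinearMap.mkContinuousOfExistsBound
    { toFun := fun f => ⟨fun i => m i * f i, by
        obtain ⟨C, hC⟩ := hm
        refine memℓp_gen (((lp.memℓp f).summable (by simp)).mul_left (C ^ 2) |>.of_nonneg_of_le
          (fun i => by positivity) fun i => ?_)
        simp only [ENNReal.toReal_ofNat, Real.rpow_ofNat, norm_mul, mul_pow]
        gcongr
        exact hC i⟩
      map_add' := fun f g => by ext i; exact mul_add _ _ _
      map_smul' := fun r f => by ext i; simp [mul_left_comm] } (by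
    obtain ⟨C, hC⟩ := hm
    refine ⟨|C|, fun f => ?_⟩
    refine lp.norm_le_of_forall_sum_le (by simp) (by positivity) fun s => ?_
    simp only [LinearMap.coe_mk, AddHom.coe_mk, norm_mul, ENNReal.toReal_ofNat, Real.rpow_ofNat,
      mul_pow]
    calc ∑ i ∈ s, ‖m i‖ ^ 2 * ‖f i‖ ^ 2 ≤ ∑ i ∈ s, |C| ^ 2 * ‖f i‖ ^ 2 := by
          gcongr with i _
          exact (hC i).trans (le_abs_self C)
      _ = |C| ^ 2 * ∑ i ∈ s, ‖f i‖ ^ 2 := by rw [Finset.mul_sum]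
      _ ≤ |C| ^ 2 * ‖f‖ ^ 2 := by
          gcongr
          simpa using lp.sum_rpow_le_norm_rpow (p := 2) (by simp) f s)

@[simp]
theorem diagonalOperator_apply (m : ι → ℂ) (hm : ∃ C, ∀ i, ‖m i‖ ≤ C)
    (f : lp (fun _ : ι => ℂ) 2) (i : ι) : diagonalOperator m hm f i = m i * f i :=
  rfl

/-- The real part of `θ ⟨f, m f⟩` is the sum of `Re (θ m i) ‖f i‖²`: rotating by `θ` prevents
cancellation. -/
theorem diagonalOperator_coercive (m : ι → ℂ) (hm : ∃ C, ∀ i, ‖m i‖ ≤ C) {θ : ℂ} {δ : ℝ}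
    (hδ : ∀ i, δ ≤ (θ * m i).re) (f : lp (fun _ : ι => ℂ) 2) :
    δ * ‖f‖ ^ 2 ≤ ‖θ‖ * ‖inner ℂ f (diagonalOperator m hm f)‖ := by
  rw [← norm_mul]
  refine le_trans ?_ (Complex.re_le_norm _)
  have h1 := Complex.hasSum_re ((lp.hasSum_inner (𝕜 := ℂ) f (diagonalOperator m hm f)).mul_left θ)
  have h2 := (Complex.hasSum_re (lp.hasSum_inner (𝕜 := ℂ) f f)).mul_left δ
  have h3 : (inner ℂ f f).re = ‖f‖ ^ 2 := inner_self_eq_norm_sq (𝕜 := ℂ) f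
  rw [h3] at h2
  refine hasSum_le (fun i => ?_) h2 h1
  have e1 : inner ℂ (f i) (f i) = ((‖f i‖ ^ 2 : ℝ) : ℂ) := by
    rw [inner_self_eq_norm_sq_to_K]; simp
  have e2 : θ * inner ℂ (f i) (diagonalOperator m hm f i) =
      ((‖f i‖ ^ 2 : ℝ) : ℂ) * (θ * m i) := by
    rw [diagonalOperator_apply, ← smul_eq_mul (m i), inner_smul_right, e1]; ring
  rw [e2, e1, Complex.re_ofReal_mul, Complex.ofReal_re, mul_comm]
  exact mul_le_mul_of_nonneg_left (hδ i) (by positivity)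

/-- The operator `s (1 - T + s² T)⁻¹`, where `T` is the diagonal operator with entries `t`. -/
noncomputable def admittanceOperator (t : ι → ℝ) (ht : ∃ C, ∀ i, ‖(t i : ℂ)‖ ≤ C) (s : ℂ) :
    lp (fun _ : ι => ℂ) 2 →L[ℂ] lp (fun _ : ι => ℂ) 2 :=
  s • Ring.inverse (1 + (s ^ 2 - 1) • diagonalOperator (fun i => (t i : ℂ)) ht)

/-- All the numbers `1 - t + s² t` lie in a half plane whose boundary line passes at a positive
distance from the origin. -/
def IsSectorial (t : ι → ℝ) (s : ℂ) : Prop :=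
  ∃ θ : ℂ, ∃ δ > 0, ∀ i, δ ≤ (θ * (t i * s ^ 2 + (1 - t i))).re

section

variable {t : ι → ℝ} {s : ℂ}

theorem IsSectorial.ne_zero (h : IsSectorial t s) (i : ι) :
    (t i * s ^ 2 + (1 - t i) : ℂ) ≠ 0 := by
  obtain ⟨θ, δ, hδ, hb⟩ := h
  intro h0
  have := hb i
  rw [h0, mul_zero, Complex.zero_re] at this
  linarith

theorem IsSectorial.bounded_inv (h : IsSectorial t s) :
    ∃ C, ∀ i, ‖(t i * s ^ 2 + (1 - t i) : ℂ)⁻¹‖ ≤ C := by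
  have hne := h.ne_zero
  obtain ⟨θ, δ, hδ, hb⟩ := h
  refine ⟨‖θ‖ / δ, fun i => ?_⟩
  have h1 := (hb i).trans (Complex.re_le_norm _)
  rw [norm_mul] at h1
  rw [norm_inv, inv_le_comm₀ (norm_pos_iff.2 (hne i)) (by
    refine div_pos (lt_of_le_of_ne (norm_nonneg _) fun h0 => ?_) hδ
    rw [← h0, zero_mul] at h1; linarith), inv_div]
  exact div_le_of_le_mul₀ (norm_nonneg _) (norm_nonneg _) (by linarith)

variable (ht : ∃ C, ∀ i, ‖(t i : ℂ)‖ ≤ C)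

/-- Links the two views of the inverse: as an inverse of an operator polynomial it is differentiable
in `s`, as a diagonal operator it has explicit entries. -/
theorem IsSectorial.exists_unit (h : IsSectorial t s) :
    ∃ u : (lp (fun _ : ι => ℂ) 2 →L[ℂ] lp (fun _ : ι => ℂ) 2)ˣ,
      (u : _ →L[ℂ] _) = 1 + (s ^ 2 - 1) • diagonalOperator (fun i => (t i : ℂ)) ht ∧
      ((u⁻¹ : Units _) : _ →L[ℂ] _) = diagonalOperator _ h.bounded_inv := by
  refine ⟨⟨1 + (s ^ 2 - 1) • diagonalOperator (fun i => (t i : ℂ)) ht,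
    diagonalOperator _ h.bounded_inv, ?_, ?_⟩, rfl, rfl⟩
  · ext f i
    have hi := h.ne_zero i
    change (t i * s ^ 2 + (1 - t i) : ℂ)⁻¹ * f i +
      (s ^ 2 - 1) * (t i * ((t i * s ^ 2 + (1 - t i) : ℂ)⁻¹ * f i)) = f i
    field_simp
    ring
  · ext f i
    have hi := h.ne_zero i
    change (t i * s ^ 2 + (1 - t i) : ℂ)⁻¹ * (f i + (s ^ 2 - 1) * (t i * f i)) = f i
    field_simp
    ring

theorem IsSectorial.admittanceOperator_eq (h : IsSectorial t s) :
    admittanceOperator t ht s = s • diagonalOperator _ h.bounded_inv := by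
  obtain ⟨u, h1, h2⟩ := h.exists_unit ht
  rw [admittanceOperator, ← h1, Ring.inverse_unit, h2]

theorem IsSectorial.admittanceOperator_apply (h : IsSectorial t s)
    (f : lp (fun _ : ι => ℂ) 2) (i : ι) :
    admittanceOperator t ht s f i = s / (t i * s ^ 2 + (1 - t i)) * f i := by
  rw [h.admittanceOperator_eq ht]
  simp [div_eq_mul_inv, mul_assoc]

theorem IsSectorial.differentiableAt (h : IsSectorial t s) :
    DifferentiableAt ℂ (admittanceOperator t ht) s := by
  obtain ⟨u, h1, -⟩ := h.exists_unit ht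
  have h2 : DifferentiableAt ℂ
      (fun s : ℂ => 1 + (s ^ 2 - 1) • diagonalOperator (fun i => (t i : ℂ)) ht) s := by
    fun_prop
  exact differentiableAt_id.smul (h2.comp_ringInverse (h1 ▸ u.isUnit))

theorem IsSectorial.coercive (h : IsSectorial t s) (hs : s ≠ 0) :
    ∃ c > 0, ∀ f, c * ‖f‖ ^ 2 ≤ ‖inner ℂ f (admittanceOperator t ht s f)‖ := by
  have hne := h.ne_zero
  have hbi := h.bounded_inv
  simp only [h.admittanceOperator_eq ht]
  obtain ⟨θ, δ, hδ, hb⟩ := h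
  obtain ⟨C, hC⟩ := ht
  set M : ℝ := |C| * ‖s‖ ^ 2 + (1 + |C|) with hM
  have hM0 : 0 < M := by positivity
  -- Inversion preserves the sector up to conjugation: `Re (conj θ / z) = Re (θ z) / ‖z‖²`, and `M`
  -- bounds `‖z‖` uniformly in `i`.
  have key : ∀ i, δ / M ^ 2 ≤
      (starRingEnd ℂ θ * (t i * s ^ 2 + (1 - t i) : ℂ)⁻¹).re := fun i => by
    have hti : ‖(t i : ℂ)‖ ≤ |C| := (hC i).trans (le_abs_self C)
    have hz : ‖(t i * s ^ 2 + (1 - t i) : ℂ)‖ ≤ M := by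
      refine (norm_add_le _ _).trans (add_le_add ?_ ((norm_sub_le _ _).trans ?_))
      · rw [norm_mul, norm_pow]; gcongr
      · rw [norm_one]; gcongr
    set z : ℂ := t i * s ^ 2 + (1 - t i)
    have hz0 : 0 < ‖z‖ := norm_pos_iff.2 (hne i)
    have e : starRingEnd ℂ θ * z⁻¹ = starRingEnd ℂ (θ * z) * (((‖z‖ ^ 2)⁻¹ : ℝ) : ℂ) := by
      rw [Complex.inv_def, Complex.normSq_eq_norm_sq, map_mul, mul_assoc]
    rw [e, Complex.re_mul_ofReal, Complex.conj_re, ← div_eq_mul_inv]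
    have h1 : δ ≤ (θ * z).re := hb i
    have h2 : 0 ≤ (θ * z).re := hδ.le.trans h1
    gcongr
  -- The `+ 1` covers `θ = 0`, which is possible for an empty index type.
  refine ⟨‖s‖ * (δ / M ^ 2) / (‖θ‖ + 1), by positivity, fun f => ?_⟩
  have h1 := diagonalOperator_coercive _ hbi key f
  rw [RCLike.norm_conj] at h1
  rw [smul_apply, inner_smul_right, norm_mul, div_mul_eq_mul_div,
    div_le_iff₀ (by positivity), mul_assoc, mul_assoc]
  refine mul_le_mul_of_nonneg_left (h1.trans ?_) (norm_nonneg s)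
  rw [mul_comm]
  gcongr
  simp

end

end Diagonal

namespace RLCGraph

/-! ### Parameters outside the exceptional set -/

section Parameters

variable {V : Type*} (N : RLCGraph V)

theorem coe_D {e : Sym2 V} (he : e ∈ N.graph.edgeSet) : (N.D e : ℝ≥0∞) = (N.C e)⁻¹ :=
  ENNReal.coe_toNNReal (ENNReal.inv_ne_top.2 (N.C_ne_zero e he))

theorem L_add_D_pos (hR : ∀ e ∈ N.graph.edgeSet, N.R e = 0) {e : Sym2 V}
    (he : e ∈ N.graph.edgeSet) : 0 < N.L e + N.D e := by
  have h := N.pos e he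
  rw [hR e he, ← N.coe_D he, ENNReal.coe_zero, zero_add] at h
  exact_mod_cast h

/-- The relative inductance `L / (L + D)` of an oriented edge. -/
noncomputable def relInductance (d : N.graph.Dart) : ℝ :=
  N.L d.edge / (N.L d.edge + N.D d.edge)

theorem relInductance_mem_Icc (d : N.graph.Dart) : N.relInductance d ∈ Set.Icc (0 : ℝ) 1 := by
  have h1 : (0 : ℝ) ≤ N.L d.edge := NNReal.coe_nonneg _
  have h2 : (0 : ℝ) ≤ N.D d.edge := NNReal.coe_nonneg _
  exact ⟨by unfold relInductance; positivity,
    div_le_one_of_le₀ (le_add_of_nonneg_right h2) (by positivity)⟩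

theorem relInductance_bounded : ∃ C, ∀ d, ‖(N.relInductance d : ℂ)‖ ≤ C :=
  ⟨1, fun d => by
    rw [Complex.norm_real, Real.norm_of_nonneg (N.relInductance_mem_Icc d).1]
    exact (N.relInductance_mem_Icc d).2⟩

theorem mem_imInterval {α β : EReal} {s : ℂ} :
    s ∈ imInterval α β ↔ s.re = 0 ∧ α ≤ (s.im : EReal) ∧ (s.im : EReal) ≤ β := by
  constructor
  · rintro ⟨y, h1, h2, rfl⟩
    simpa using ⟨h1, h2⟩
  · rintro ⟨h0, h1, h2⟩
    exact ⟨s.im, h1, h2, Complex.ext (by simp [h0]) (by simp)⟩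

theorem isClosed_imInterval (α β : EReal) : IsClosed (imInterval α β) := by
  have : imInterval α β = {s | s.re = 0} ∩
      ({s | α ≤ (s.im : EReal)} ∩ {s | (s.im : EReal) ≤ β}) := by
    ext s; exact mem_imInterval
  rw [this]
  have hc : Continuous fun s : ℂ => (s.im : EReal) :=
    continuous_coe_real_ereal.comp Complex.continuous_im
  exact (isClosed_eq Complex.continuous_re continuous_const).inter
    ((isClosed_le continuous_const hc).inter (isClosed_le hc continuous_const))

theorem isClosed_exceptionalSet : IsClosed N.exceptionalSet :=
  ((isClosed_imInterval _ _).union (isClosed_imInterval _ _)).union isClosed_singleton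

theorem supD_le_supCL (hR : ∀ e ∈ N.graph.edgeSet, N.R e = 0) : N.supD ≤ N.supCL := by
  refine iSup₂_mono fun e he => ?_
  have h := N.L_add_D_pos hR he
  rw [N.coe_D he, one_div, ENNReal.mul_inv (.inl (N.C_ne_zero e he)), div_eq_mul_inv]
  -- The inverse of `C * L` splits except for `C = ∞`, `L = 0`, where `∞ * 0 = 0`; positivity of `L
  -- + D` excludes this.
  by_contra! hh
  obtain ⟨h1, h2⟩ : N.C e = ⊤ ∧ (N.L e : ℝ≥0∞) = 0 := by tauto
  have h3 : N.D e = 0 := by simp [D, h1]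
  rw [h3, ENNReal.coe_eq_zero.1 h2] at h
  simp at h

theorem sqrtE_mono : Monotone sqrtE := fun _ _ h =>
  EReal.coe_ennreal_le_coe_ennreal_iff.2 (ENNReal.rpow_le_rpow h (by norm_num))

theorem sqrtE_nonneg (t : ℝ≥0∞) : 0 ≤ sqrtE t := EReal.coe_ennreal_nonneg _

theorem exceptionalSet_subset (hR : ∀ e ∈ N.graph.edgeSet, N.R e = 0) :
    N.exceptionalSet ⊆ imInterval (-sqrtE N.supCL) (sqrtE N.supCL) := by
  have h := sqrtE_mono (N.supD_le_supCL hR)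
  have h0 := sqrtE_nonneg N.supCL
  have hneg : -sqrtE N.supCL ≤ 0 := by simpa using EReal.neg_le_neg_iff.2 h0
  rintro s ((hs | hs) | rfl)
  · rw [mem_imInterval] at hs ⊢
    exact ⟨hs.1, hneg.trans ((sqrtE_nonneg _).trans hs.2.1), hs.2.2.trans h⟩
  · rw [mem_imInterval] at hs ⊢
    refine ⟨hs.1, (EReal.neg_le_neg_iff.2 h).trans hs.2.1, hs.2.2.trans (le_trans ?_ h0)⟩
    simpa using EReal.neg_le_neg_iff.2 (sqrtE_nonneg N.infD)
  · rw [mem_imInterval]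
    simpa using h0

theorem coe_lt_sqrtE {r : ℝ≥0} {t : ℝ≥0∞} : ((r : ℝ) : EReal) < sqrtE t ↔ (r : ℝ≥0∞) ^ 2 < t := by
  have h : ((r : ℝ) : EReal) = ((r : ℝ≥0∞) : EReal) :=
    (EReal.coe_nnreal_eq_coe_real r).symm
  rw [sqrtE, h, EReal.coe_ennreal_lt_coe_ennreal_iff, one_div,
    ENNReal.lt_rpow_inv_iff (by norm_num)]
  norm_num

theorem sqrtE_lt_coe {r : ℝ≥0} {t : ℝ≥0∞} : sqrtE t < ((r : ℝ) : EReal) ↔ t < (r : ℝ≥0∞) ^ 2 := by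
  have h : ((r : ℝ) : EReal) = ((r : ℝ≥0∞) : EReal) :=
    (EReal.coe_nnreal_eq_coe_real r).symm
  rw [sqrtE, h, EReal.coe_ennreal_lt_coe_ennreal_iff, one_div,
    ENNReal.rpow_inv_lt_iff (by norm_num)]
  norm_num

theorem lt_infD_or_supD_lt {s : ℂ} (hs : s ∉ N.exceptionalSet) (h0 : s.re = 0) :
    (‖s.im‖₊ : ℝ≥0∞) ^ 2 < N.infD ∨ N.supD < (‖s.im‖₊ : ℝ≥0∞) ^ 2 := by
  rw [← coe_lt_sqrtE, ← sqrtE_lt_coe]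
  by_contra! h
  rw [coe_nnnorm, Real.norm_eq_abs] at h
  refine hs (.inl ?_)
  rcases le_total 0 s.im with hy | hy
  · rw [abs_of_nonneg hy] at h
    exact .inl (mem_imInterval.2 ⟨h0, h⟩)
  · rw [abs_of_nonpos hy, EReal.coe_neg] at h
    exact .inr (mem_imInterval.2 ⟨h0, EReal.neg_le.1 h.2, EReal.le_neg_of_le_neg h.1⟩)

/-- For `s = i y` the numbers are the reals `1 - t (1 + y²)`, whose sign is that of `D / L - y²`
when `L > 0`. Otherwise `s²` is off the closed negative half line, and no information on `D / L` is
needed. -/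
theorem isSectorial (hR : ∀ e ∈ N.graph.edgeSet, N.R e = 0) {s : ℂ}
    (hs : s ∉ N.exceptionalSet) : IsSectorial N.relInductance s := by
  by_cases h0 : s.re = 0
  · have hsq : s ^ 2 = ((-(s.im ^ 2) : ℝ) : ℂ) := by
      apply Complex.ext <;> simp [sq, h0]
    have hre : ∀ (θ t : ℝ), ((θ : ℂ) * (t * s ^ 2 + (1 - t))).re =
        θ * (1 - t * (1 + s.im ^ 2)) := fun θ t => by
      rw [hsq, ← Complex.ofReal_one, ← Complex.ofReal_sub, ← Complex.ofReal_mul,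
        ← Complex.ofReal_add, ← Complex.ofReal_mul, Complex.ofReal_re]
      ring
    have hy : ∀ k : ℝ≥0, ((‖s.im‖₊ : ℝ≥0∞) ^ 2 < k ↔ s.im ^ 2 < k) ∧
        ((k : ℝ≥0∞) < (‖s.im‖₊ : ℝ≥0∞) ^ 2 ↔ (k : ℝ) < s.im ^ 2) := fun k => by
      rw [← ENNReal.coe_pow, ENNReal.coe_lt_coe, ENNReal.coe_lt_coe, ← NNReal.coe_lt_coe,
        ← NNReal.coe_lt_coe]
      simp
    have hpos : ∀ d : N.graph.Dart, (0 : ℝ) < N.L d.edge + N.D d.edge := fun d => by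
      exact_mod_cast N.L_add_D_pos hR d.edge_mem
    rcases N.lt_infD_or_supD_lt hs h0 with h | h
    -- A finite `k` strictly between `y²` and the infimum gives a uniform gap even if the infimum is
    -- `∞`; `D / L ≥ k` means `t ≤ 1 / (1 + k)`.
    · obtain ⟨k, hk, hki⟩ := ENNReal.lt_iff_exists_nnreal_btwn.1 h
      rw [(hy k).1] at hk
      refine ⟨(1 : ℝ), (k - s.im ^ 2) / (1 + k),
        div_pos (sub_pos.2 hk) (by positivity), fun d => ?_⟩
      have hd : (k : ℝ≥0∞) ≤ N.D d.edge / N.L d.edge := hki.le.trans (iInf₂_le _ d.edge_mem)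
      have hd' : (k : ℝ) * N.L d.edge ≤ N.D d.edge := by
        have := ENNReal.mul_le_of_le_div hd
        exact_mod_cast this
      have ht : N.relInductance d ≤ 1 / (1 + k) := by
        rw [relInductance, div_le_div_iff₀ (hpos d) (by positivity)]
        linarith
      rw [hre]
      calc (k - s.im ^ 2) / (1 + k) = 1 - 1 / (1 + k) * (1 + s.im ^ 2) := by
            field_simp; ring
        _ ≤ 1 * (1 - N.relInductance d * (1 + s.im ^ 2)) := by rw [one_mul]; gcongr
    · obtain ⟨k, hks, hk⟩ := ENNReal.lt_iff_exists_nnreal_btwn.1 h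
      rw [(hy k).2] at hk
      refine ⟨(-1 : ℝ), (s.im ^ 2 - k) / (1 + k),
        div_pos (sub_pos.2 hk) (by positivity), fun d => ?_⟩
      have hd : (N.D d.edge : ℝ≥0∞) / N.L d.edge ≤ k :=
        (le_iSup₂ (f := fun e (_ : e ∈ N.graph.edgeSet) => (N.D e : ℝ≥0∞) / N.L e) d.edge
          d.edge_mem).trans hks.le
      have hL : (N.L d.edge : ℝ≥0∞) ≠ 0 := by
        intro hL
        have hD : (N.D d.edge : ℝ≥0∞) ≠ 0 := by
          intro hD
          have := N.L_add_D_pos hR d.edge_mem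
          rw [ENNReal.coe_eq_zero.1 hL, ENNReal.coe_eq_zero.1 hD] at this
          simp at this
        rw [hL, ENNReal.div_zero hD] at hd
        simp at hd
      have hd' : (N.D d.edge : ℝ) ≤ k * N.L d.edge := by
        have := (ENNReal.div_le_iff hL ENNReal.coe_ne_top).1 hd
        exact_mod_cast this
      have ht : 1 / (1 + k) ≤ N.relInductance d := by
        rw [relInductance, div_le_div_iff₀ (by positivity) (hpos d)]
        linarith
      rw [hre]
      calc (s.im ^ 2 - k) / (1 + k) = 1 / (1 + k) * (1 + s.im ^ 2) - 1 := by
            field_simp; ring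
        _ ≤ N.relInductance d * (1 + s.im ^ 2) - 1 := by gcongr
        _ = -1 * (1 - N.relInductance d * (1 + s.im ^ 2)) := by ring
  · set w := s ^ 2 with hw
    have hwn : ‖w‖ = s.re ^ 2 + s.im ^ 2 := by
      rw [hw, norm_pow, Complex.sq_norm, Complex.normSq_apply]; ring
    have hwr : w.re = s.re ^ 2 - s.im ^ 2 := by simp [hw, sq]
    have hpos : 0 < ‖w‖ + w.re := by
      rw [hwn, hwr]
      have : 0 < s.re ^ 2 := by positivity
      linarith
    have hw0 : 0 < ‖w‖ := norm_pos_iff.2 (by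
      rw [hw]; exact pow_ne_zero 2 fun h => h0 (by rw [h, Complex.zero_re]))
    -- `‖w‖ + w` bisects the angle between `1` and `w`; its conjugate turns both endpoints of the
    -- segment into the right half plane.
    refine ⟨‖w‖ + starRingEnd ℂ w, min ‖w‖ 1 * (‖w‖ + w.re), by positivity, fun d => ?_⟩
    set t := N.relInductance d with ht
    obtain ⟨ht0, ht1⟩ := N.relInductance_mem_Icc d
    have e : ((‖w‖ + starRingEnd ℂ w) * (t * w + (1 - t))).re =
        (t * ‖w‖ + (1 - t) * 1) * (‖w‖ + w.re) := by
      have h1 : starRingEnd ℂ w * w = ((‖w‖ ^ 2 : ℝ) : ℂ) := by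
        rw [mul_comm, Complex.mul_conj, Complex.normSq_eq_norm_sq]
      have h2 : (‖w‖ + starRingEnd ℂ w) * (t * w + (1 - t)) =
          ((t * ‖w‖ : ℝ) : ℂ) * w + ((t * ‖w‖ ^ 2 : ℝ) : ℂ) + (((1 - t) * ‖w‖ : ℝ) : ℂ) +
          ((1 - t : ℝ) : ℂ) * starRingEnd ℂ w := by
        push_cast at h1 ⊢
        linear_combination (t : ℂ) * h1
      rw [h2]
      simp only [Complex.add_re, Complex.re_ofReal_mul, Complex.ofReal_re, Complex.conj_re]
      ring
    rw [e]
    refine mul_le_mul_of_nonneg_right ?_ hpos.le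
    have h1 : t * min ‖w‖ 1 ≤ t * ‖w‖ := mul_le_mul_of_nonneg_left (min_le_left _ _) ht0
    have h2 : (1 - t) * min ‖w‖ 1 ≤ (1 - t) * 1 :=
      mul_le_mul_of_nonneg_left (min_le_right _ _) (sub_nonneg.2 ht1)
    linarith

theorem ne_zero_of_notMem_exceptionalSet {s : ℂ} (hs : s ∉ N.exceptionalSet) : s ≠ 0 :=
  fun h => hs (.inr h)

theorem impedance_eq (hR : ∀ e ∈ N.graph.edgeSet, N.R e = 0) {s : ℂ} (hs : s ≠ 0)
    (d : N.graph.Dart) :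
    N.impedance s d.edge = ((N.L d.edge + N.D d.edge : ℝ) : ℂ) *
      ((N.relInductance d * s ^ 2 + (1 - N.relInductance d)) / s) := by
  have h : ((N.L d.edge : ℝ) : ℂ) + ((N.D d.edge : ℝ) : ℂ) ≠ 0 := by
    exact_mod_cast (N.L_add_D_pos hR d.edge_mem).ne'
  rw [impedance, hR _ d.edge_mem, relInductance]
  push_cast
  field_simp
  ring

theorem mem_regularSet (hR : ∀ e ∈ N.graph.edgeSet, N.R e = 0) {s : ℂ}
    (hs : s ∉ N.exceptionalSet) : s ∈ N.regularSet := by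
  have hs0 := N.ne_zero_of_notMem_exceptionalSet hs
  refine ⟨hs0, fun e => ?_⟩
  induction e using Sym2.ind with
  | _ x y =>
    intro he
    let d : N.graph.Dart := ⟨(x, y), he⟩
    have h : ((N.L d.edge + N.D d.edge : ℝ) : ℂ) ≠ 0 := by
      exact_mod_cast (N.L_add_D_pos hR d.edge_mem).ne'
    change N.impedance s d.edge ≠ 0
    rw [N.impedance_eq hR hs0]
    exact mul_ne_zero h (div_ne_zero ((N.isSectorial hR hs).ne_zero d) hs0)

end Parameters

end RLCGraph

namespace RLCGraph

/-! ### The energy space -/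

section EnergySpace

variable {V : Type*} (N : RLCGraph V)

theorem admittance_symm (s : ℂ) (x y : V) : N.admittance s x y = N.admittance s y x := by
  have h := N.graph.adj_comm x y
  rw [admittance, admittance, Sym2.eq_swap]
  split_ifs <;> tauto

/-- The square root of the reference conductance `1 / (L + D)` of an edge. -/
noncomputable def sqrtConductance (e : Sym2 V) : ℝ := √((N.L e + N.D e : ℝ)⁻¹)

theorem admittance_eq (hR : ∀ e ∈ N.graph.edgeSet, N.R e = 0) {s : ℂ} (hs : s ≠ 0)
    (d : N.graph.Dart) :
    N.admittance s d.fst d.snd = (N.sqrtConductance d.edge : ℂ) ^ 2 *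
      (s / (N.relInductance d * s ^ 2 + (1 - N.relInductance d))) := by
  rw [admittance, if_pos d.adj]
  change 1 / N.impedance s d.edge = _
  rw [N.impedance_eq hR hs, sqrtConductance, ← Complex.ofReal_pow, Real.sq_sqrt (by positivity),
    one_div, mul_inv, inv_div, Complex.ofReal_inv]

variable [N.graph.LocallyFinite]

open Classical in
/-- The normalized gradient of the indicator function of a vertex. -/
noncomputable def nodeVector (x : V) : lp (fun _ : N.graph.Dart => ℂ) 2 :=
  ∑ y : N.graph.neighborSet x, (N.sqrtConductance s(x, y) : ℂ) •
    (lp.single 2 (N.graph.dartOfNeighborSet x y) 1 -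
      lp.single 2 (N.graph.dartOfNeighborSet x y).symm 1)

theorem inner_nodeVector (x : V) (f : lp (fun _ : N.graph.Dart => ℂ) 2) :
    inner ℂ (N.nodeVector x) f = ∑ y : N.graph.neighborSet x, (N.sqrtConductance s(x, y) : ℂ) *
      (f (N.graph.dartOfNeighborSet x y) - f (N.graph.dartOfNeighborSet x y).symm) := by
  simp [nodeVector, lp.inner_single_left]

open Classical in
theorem sum_sqrtConductance_ite (x : V) (d : N.graph.Dart) :
    ∑ y : N.graph.neighborSet x, (N.sqrtConductance s(x, y) : ℂ) *
      (if d = N.graph.dartOfNeighborSet x y then 1 else 0) =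
    if d.fst = x then (N.sqrtConductance d.edge : ℂ) else 0 := by
  split_ifs with h
  · subst h
    rw [Finset.sum_eq_single ⟨d.snd, d.adj⟩]
    · exact (congrArg _ (if_pos rfl)).trans (mul_one _)
    · intro y _ hy
      rw [if_neg, mul_zero]
      rintro h
      exact hy (Subtype.ext (congrArg (fun d : N.graph.Dart => d.snd) h).symm)
    · simp
  · refine Finset.sum_eq_zero fun y _ => ?_
    rw [if_neg, mul_zero]
    rintro rfl
    exact h rfl

open Classical in
theorem nodeVector_apply (x : V) (d : N.graph.Dart) :
    N.nodeVector x d = (N.sqrtConductance d.edge : ℂ) *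
      ((if d.fst = x then 1 else 0) - if d.snd = x then 1 else 0) := by
  have h : N.nodeVector x d =
      ∑ y : N.graph.neighborSet x, (N.sqrtConductance s(x, y) : ℂ) *
        (if d = N.graph.dartOfNeighborSet x y then 1 else 0) -
      ∑ y : N.graph.neighborSet x, (N.sqrtConductance s(x, y) : ℂ) *
        (if d.symm = N.graph.dartOfNeighborSet x y then 1 else 0) := by
    rw [← Finset.sum_sub_distrib, nodeVector, lp.coeFn_sum, Finset.sum_apply]
    refine Finset.sum_congr rfl fun y _ => ?_
    have e : d.symm = N.graph.dartOfNeighborSet x y ↔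
        d = (N.graph.dartOfNeighborSet x y).symm :=
      SimpleGraph.Dart.symm_involutive.eq_iff
    simp only [lp.coeFn_smul, lp.coeFn_sub, Pi.smul_apply, Pi.sub_apply, lp.single_apply,
      smul_eq_mul, Pi.single_apply, e, mul_sub]
  rw [h, sum_sqrtConductance_ite, sum_sqrtConductance_ite, SimpleGraph.Dart.edge_symm, mul_sub]
  congr 1
  · split_ifs <;> simp
  · change (if d.snd = x then _ else _) = _
    split_ifs <;> simp

/-- Identifies linear combinations of node vectors with weighted gradients of finitely supported
potentials. -/
theorem sum_smul_nodeVector_apply {v : V → ℂ} {S : Finset V} (hv : ∀ x ∉ S, v x = 0)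
    (d : N.graph.Dart) :
    (∑ x ∈ S, v x • N.nodeVector x : lp (fun _ : N.graph.Dart => ℂ) 2) d =
      (N.sqrtConductance d.edge : ℂ) * (v d.fst - v d.snd) := by
  classical
  have h : ∀ z, ∑ x ∈ S, v x * (if z = x then 1 else 0) = v z := fun z => by
    simp only [mul_ite, mul_one, mul_zero, Finset.sum_ite_eq]
    split_ifs with hz
    · rfl
    · exact (hv z hz).symm
  rw [lp.coeFn_sum, Finset.sum_apply, ← h d.fst, ← h d.snd, ← Finset.sum_sub_distrib,
    Finset.mul_sum]
  refine Finset.sum_congr rfl fun x _ => ?_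
  rw [lp.coeFn_smul, Pi.smul_apply, nodeVector_apply, smul_eq_mul]
  ring

/-- The admittance operator of the network on the energy space. -/
noncomputable abbrev networkOperator (s : ℂ) :
    lp (fun _ : N.graph.Dart => ℂ) 2 →L[ℂ] lp (fun _ : N.graph.Dart => ℂ) 2 :=
  admittanceOperator N.relInductance N.relInductance_bounded s

/-- Discrete Green formula: pairing with a node vector gives the net current out of that vertex,
twice because both orientations of an edge contribute equally. -/
theorem inner_nodeVector_networkOperator (hR : ∀ e ∈ N.graph.edgeSet, N.R e = 0) {s : ℂ}
    (hs : s ∉ N.exceptionalSet) {v : V → ℂ} {S : Finset V} (hv : ∀ x ∉ S, v x = 0) (x : V) :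
    inner ℂ (N.nodeVector x) (N.networkOperator s (∑ x ∈ S, v x • N.nodeVector x)) =
      2 * ∑ y : N.graph.neighborSet x, (v x - v y) * N.admittance s x y := by
  rw [inner_nodeVector, Finset.mul_sum]
  refine Finset.sum_congr rfl fun y _ => ?_
  have hsec := N.isSectorial hR hs
  rw [hsec.admittanceOperator_apply, hsec.admittanceOperator_apply,
    N.sum_smul_nodeVector_apply hv, N.sum_smul_nodeVector_apply hv]
  set d := N.graph.dartOfNeighborSet x y
  have h1 : N.relInductance d.symm = N.relInductance d := by
    simp only [relInductance, SimpleGraph.Dart.edge_symm]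
  have h2 := N.admittance_eq hR (N.ne_zero_of_notMem_exceptionalSet hs) d
  change N.admittance s x y = (N.sqrtConductance s(x, y) : ℂ) ^ 2 * _ at h2
  rw [h1, SimpleGraph.Dart.edge_symm, h2]
  change (N.sqrtConductance s(x, y) : ℂ) *
    (_ / _ * ((N.sqrtConductance s(x, y) : ℂ) * (v x - v y)) -
      _ / _ * ((N.sqrtConductance s(x, y) : ℂ) * (v y - v x))) = _
  ring

end EnergySpace

/-! ### Finite networks -/

section FiniteNetwork

variable {V : Type*} (N : RLCGraph V)

theorem finite_ball (hconn : N.graph.Connected) (hfin : ∀ x, (N.graph.neighborSet x).Finite)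
    (n : ℕ) (a : V) : (N.ball a n).Finite := by
  induction n generalizing a with
  | zero =>
    refine (Set.finite_singleton a).subset fun x hx => ?_
    exact ((hconn.dist_eq_zero_iff).1 (Nat.le_zero.1 hx)).symm
  | succ n ih =>
    -- A geodesic from `a` is trivial or passes through a neighbour `b`, leaving at most `n` steps;
    -- hence the induction over all centres.
    refine ((Set.finite_singleton a).union ((hfin a).biUnion fun b _ => ih b)).subset ?_
    intro x hx
    obtain ⟨p, hp⟩ := hconn.exists_walk_length_eq_dist a x
    have hx : N.graph.dist a x ≤ n + 1 := hx
    rw [← hp] at hx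
    cases p with
    | nil => exact .inl rfl
    | cons h q =>
      refine .inr (Set.mem_biUnion h ((SimpleGraph.dist_le q).trans ?_))
      simpa using hx

theorem restrict_admittance (W : Set V) (s : ℂ) (x y : W) :
    (N.restrict W).admittance s x y = N.admittance s x y := rfl

theorem finsum_restrict [N.graph.LocallyFinite] {W : Set V} {x : V} (s : ℂ)
    (hW : N.graph.neighborSet x ⊆ W) (F : V → ℂ) :
    ∑ᶠ y : W, F y * N.admittance s x y =
      ∑ y : N.graph.neighborSet x, F y * N.admittance s x y := by
  rw [← finsum_eq_sum_of_fintype, finsum_set_coe_eq_finsum_mem W (f := fun y => F y * _),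
    finsum_set_coe_eq_finsum_mem (N.graph.neighborSet x) (f := fun y => F y * _)]
  refine finsum_mem_inter_support_eq _ _ _ (Set.Subset.antisymm ?_ ?_)
  · rintro y ⟨-, hy⟩
    refine ⟨?_, hy⟩
    by_contra h
    refine hy ?_
    change F y * N.admittance s x y = 0
    rw [admittance, if_neg (show ¬N.graph.Adj x y from h), mul_zero]
  · exact Set.inter_subset_inter_left _ hW

/-- The vertices of the open ball of radius `n` at which a voltage is not prescribed. -/
def innerVertices (a : V) (B : Set V) (n : ℕ) : Set V :=
  {x | x ∉ B ∧ x ≠ a ∧ N.graph.dist a x < n}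

variable {N} {a : V} {B : Set V} {n : ℕ}

theorem neighborSet_subset_ball (hconn : N.graph.Connected) {x : V}
    (hx : N.graph.dist a x < n) : N.graph.neighborSet x ⊆ N.ball a n := by
  intro y hy
  have h1 := hconn.dist_triangle (u := a) (v := x) (w := y)
  have h2 : N.graph.dist x y = 1 := SimpleGraph.dist_eq_one_iff_adj.2 hy
  change N.graph.dist a y ≤ n
  omega

variable (N a B) in
/-- The subspace of the energy space spanned by the inner vertices. -/
noncomputable def innerSpace [N.graph.LocallyFinite] (n : ℕ) :
    Submodule ℂ (lp (fun _ : N.graph.Dart => ℂ) 2) :=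
  Submodule.span ℂ (N.nodeVector '' N.innerVertices a B n)

theorem innerSpace_mono [N.graph.LocallyFinite] : Monotone (N.innerSpace a B) := fun _ _ h =>
  Submodule.span_mono (Set.image_mono fun _ hx => ⟨hx.1, hx.2.1, hx.2.2.trans_le h⟩)

theorem finite_innerVertices (hconn : N.graph.Connected)
    (hfin : ∀ x, (N.graph.neighborSet x).Finite) : (N.innerVertices a B n).Finite :=
  (N.finite_ball hconn hfin n a).subset fun _ hx => hx.2.2.le

section

variable [N.graph.LocallyFinite] {I : Finset V} {v : V → ℂ} {s : ℂ}

theorem inner_nodeVector_add (hR : ∀ e ∈ N.graph.edgeSet, N.R e = 0) (hs : s ∉ N.exceptionalSet)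
    (haI : a ∉ I) (hva : v a = 1) (hv : ∀ x ∉ I, x ≠ a → v x = 0) (x : V) :
    inner ℂ (N.nodeVector x)
      (N.networkOperator s (N.nodeVector a + ∑ x ∈ I, v x • N.nodeVector x)) =
      2 * ∑ y : N.graph.neighborSet x, (v x - v y) * N.admittance s x y := by
  classical
  rw [← N.inner_nodeVector_networkOperator hR hs (S := insert a I) (v := v), Finset.sum_insert haI,
    hva, one_smul]
  intro x hx
  rw [Finset.mem_insert, not_or] at hx
  exact hv x hx.2 hx.1

/-- Orthogonality to `K` need only be tested on the spanning node vectors, where it is Kirchhoff's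
current law. -/
theorem isGalerkinSolution_iff (hR : ∀ e ∈ N.graph.edgeSet, N.R e = 0)
    (hs : s ∉ N.exceptionalSet) (hI : ↑I = N.innerVertices a B n) (hva : v a = 1)
    (hv : ∀ x ∉ I, x ≠ a → v x = 0) :
    IsGalerkinSolution (N.networkOperator s) (N.nodeVector a) (N.innerSpace a B n)
        (∑ x ∈ I, v x • N.nodeVector x) ↔
      ∀ x ∈ I, ∑ y : N.graph.neighborSet x, (v x - v y) * N.admittance s x y = 0 := by
  have hmem : ∀ x ∈ I, N.nodeVector x ∈ N.innerSpace a B n := fun x hx =>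
    Submodule.subset_span ⟨x, hI ▸ hx, rfl⟩
  have haI : a ∉ I := fun h => by
    have h : a ∈ N.innerVertices a B n := hI ▸ h
    exact h.2.1 rfl
  constructor
  · intro h x hx
    have := h.orthogonal _ (hmem x hx)
    rw [inner_nodeVector_add hR hs haI hva hv] at this
    simpa using this
  · intro h
    refine ⟨Submodule.sum_mem _ fun x hx => Submodule.smul_mem _ _ (hmem x hx), fun φ hφ => ?_⟩
    induction hφ using Submodule.span_induction with
    | mem φ hφ =>
      obtain ⟨x, hx, rfl⟩ := hφ
      rw [inner_nodeVector_add hR hs haI hva hv, h x (by rw [← hI] at hx; exact hx), mul_zero]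
    | zero => exact inner_zero_left _
    | add φ ψ _ _ h1 h2 => rw [inner_add_left, h1, h2, add_zero]
    | smul r φ _ h1 => rw [inner_smul_left, h1, mul_zero]

theorem laplacian_restrict_ball (hconn : N.graph.Connected) {u : N.ball a n → ℂ} {v : V → ℂ}
    (huv : ∀ x : N.ball a n, u x = v x) (x : N.ball a n) (hx : N.graph.dist a x < n) :
    (N.restrict (N.ball a n)).laplacian s u x =
      -∑ y : N.graph.neighborSet x, (v x - v y) * N.admittance s x y := by
  simp only [laplacian, huv, restrict_admittance]
  rw [N.finsum_restrict s (neighborSet_subset_ball hconn hx) (fun y => v y - v x),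
    ← Finset.sum_neg_distrib]
  exact Finset.sum_congr rfl fun y _ => by ring

/-- The effective admittance of a ball in terms of the Galerkin solution. -/
theorem partialAdmittance_eq (hconn : N.graph.Connected)
    (hfin : ∀ x, (N.graph.neighborSet x).Finite) (ha : a ∉ B)
    (hR : ∀ e ∈ N.graph.edgeSet, N.R e = 0) (hs : s ∉ N.exceptionalSet) (hn : 0 < n)
    {w : lp (fun _ : N.graph.Dart => ℂ) 2}
    (hw : IsGalerkinSolution (N.networkOperator s) (N.nodeVector a) (N.innerSpace a B n) w) :
    N.partialAdmittance a B n s =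
      ((2⁻¹ * inner ℂ (N.nodeVector a) (N.networkOperator s (N.nodeVector a + w)) : ℂ) :
        OnePoint ℂ) := by
  classical
  obtain ⟨I, hI⟩ := (finite_innerVertices (a := a) (B := B) (n := n) hconn hfin).exists_finset_coe
  have hmemI : ∀ x, x ∈ I ↔ x ∈ N.innerVertices a B n := fun x => by rw [← hI]; rfl
  have haI : a ∉ I := fun h => ((hmemI a).1 h).2.1 rfl
  have hda : N.graph.dist a a < n := by simpa using hn
  obtain ⟨c, hc, hcoer⟩ := (N.isSectorial hR hs).coercive N.relInductance_bounded
    (N.ne_zero_of_notMem_exceptionalSet hs)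
  have hex : ∃ u, (N.restrict (N.ball a n)).IsVoltage ⟨a, by simp [ball]⟩
      {x | x.1 ∈ B ∨ N.graph.dist a x.1 = n} s u := by
    have hmem := hw.mem
    rw [innerSpace, ← hI, Submodule.mem_span_image_finset_iff_exists_fun'] at hmem
    obtain ⟨r, hr⟩ := hmem
    set v : V → ℂ := fun x => if x = a then 1 else if x ∈ I then r x else 0 with hv
    have hva : v a = 1 := by simp [hv]
    have hv0 : ∀ x ∉ I, x ≠ a → v x = 0 := fun x h1 h2 => by simp [hv, h1, h2]
    have hsum : ∑ x ∈ I, v x • N.nodeVector x = w := by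
      rw [← hr]
      refine Finset.sum_congr rfl fun x hx => ?_
      have : x ≠ a := fun h => haI (h ▸ hx)
      simp [hv, hx, this]
    rw [← hsum, isGalerkinSolution_iff hR hs hI hva hv0] at hw
    refine ⟨fun x => v x, fun x hx hxa => ?_, fun x hx => ?_, hva⟩
    · rw [Set.mem_ofPred_eq, not_or] at hx
      have hxn : N.graph.dist a x < n := lt_of_le_of_ne x.2 hx.2
      rw [laplacian_restrict_ball hconn (v := v) (fun _ => rfl) x hxn, hw, neg_zero]
      exact (hmemI x).2 ⟨hx.1, fun h => hxa (Subtype.ext h), hxn⟩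
    · refine hv0 x (fun h => ?_) ?_
      · obtain ⟨h1, -, h2⟩ := (hmemI x).1 h
        exact hx.elim h1 h2.ne
      · intro h
        rcases hx with hx | hx
        · exact ha (h ▸ hx)
        · rw [h] at hx; exact hda.ne hx
  rw [partialAdmittance, effAdmittance, dif_pos hex]
  -- Whichever solution the definition selects, its extension by zero is again a Galerkin solution,
  -- so uniqueness identifies its energy vector with `w`.
  have hu := hex.choose_spec
  set u := hex.choose
  set v : V → ℂ := fun x => if h : x ∈ N.ball a n then u ⟨x, h⟩ else 0 with hv
  have huv : ∀ x : N.ball a n, u x = v x := fun x => by simp [hv]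
  have hva : v a = 1 := by rw [← hu.source]; exact (huv ⟨a, _⟩).symm
  have hv0 : ∀ x ∉ I, x ≠ a → v x = 0 := fun x hx hxa => by
    by_cases h : x ∈ N.ball a n
    · rw [← huv ⟨x, h⟩]
      refine hu.ground _ ?_
      by_contra hh
      rw [Set.mem_ofPred_eq, not_or] at hh
      exact hx ((hmemI x).2 ⟨hh.1, hxa, lt_of_le_of_ne h hh.2⟩)
    · simp [hv, h]
  have hgal : IsGalerkinSolution (N.networkOperator s) (N.nodeVector a) (N.innerSpace a B n)
      (∑ x ∈ I, v x • N.nodeVector x) := by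
    rw [isGalerkinSolution_iff hR hs hI hva hv0]
    intro x hx
    obtain ⟨hxB, hxa, hxn⟩ := (hmemI x).1 hx
    have h := hu.harmonic ⟨x, hxn.le⟩ (by simp [hxB, hxn.ne])
      (fun h => hxa (congrArg Subtype.val h))
    rw [laplacian_restrict_ball hconn huv _ hxn] at h
    exact neg_eq_zero.1 h
  rw [← hw.unique hc hcoer hgal, inner_nodeVector_add hR hs haI hva hv0,
    inv_mul_cancel_left₀ two_ne_zero, hva,
    ← N.finsum_restrict s (neighborSet_subset_ball hconn hda) (fun y => 1 - v y)]
  congr 1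
  refine finsum_congr fun x => ?_
  rw [huv, restrict_admittance, admittance_symm]

end

end FiniteNetwork

end RLCGraph

namespace RLCGraph

/-! ### Passage to the limit and holomorphy -/

section InfiniteNetwork

variable {V : Type*} (N : RLCGraph V) [N.graph.LocallyFinite]

/-- The effective admittance of the infinite network, the limit of the effective admittances
of the balls. -/
noncomputable def limitAdmittance (a : V) (B : Set V) (s : ℂ) : ℂ :=
  2⁻¹ * inner ℂ (N.nodeVector a) (N.networkOperator s (N.nodeVector a +
    galerkinSolution (⨆ n, N.innerSpace a B n).topologicalClosure (N.nodeVector a)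
      (N.networkOperator s)))

variable {N} {a : V} {B : Set V} {s : ℂ}

theorem hasEffAdmittance_limitAdmittance (hconn : N.graph.Connected)
    (hfin : ∀ x, (N.graph.neighborSet x).Finite) (ha : a ∉ B)
    (hR : ∀ e ∈ N.graph.edgeSet, N.R e = 0) (hs : s ∉ N.exceptionalSet) :
    N.HasEffAdmittance a B s (N.limitAdmittance a B s) := by
  refine ⟨N.mem_regularSet hR hs, ?_⟩
  obtain ⟨c, hc, hcoer⟩ := (N.isSectorial hR hs).coercive N.relInductance_bounded
    (N.ne_zero_of_notMem_exceptionalSet hs)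
  have hex : ∀ n, ∃ w, IsGalerkinSolution (N.networkOperator s) (N.nodeVector a)
      (N.innerSpace a B n) w := fun n => by
    -- Balls are finite, so `K_n` is finite-dimensional and hence complete, as Lax–Milgram requires.
    have : FiniteDimensional ℂ (N.innerSpace a B n) :=
      FiniteDimensional.span_of_finite ℂ ((finite_innerVertices hconn hfin).image _)
    have := FiniteDimensional.complete ℂ (N.innerSpace a B n)
    exact ⟨_, isGalerkinSolution_galerkinSolution _ hc hcoer⟩
  choose w hw using hex
  have hlim := IsGalerkinSolution.tendsto innerSpace_mono hc hcoer
    (isGalerkinSolution_galerkinSolution _ hc hcoer) (Filter.Eventually.of_forall hw)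
  have hcont : Continuous fun u => (2⁻¹ * inner ℂ (N.nodeVector a)
      (N.networkOperator s (N.nodeVector a + u)) : ℂ) := by fun_prop
  refine Filter.Tendsto.congr' ?_
    ((OnePoint.continuous_coe.tendsto _).comp ((hcont.tendsto _).comp hlim))
  -- At `n = 0` the source is grounded and the value is `∞`; the limit ignores it.
  filter_upwards [Filter.eventually_gt_atTop 0] with n hn
  exact (partialAdmittance_eq hconn hfin ha hR hs hn (hw n)).symm

theorem differentiableAt_limitAdmittance (hR : ∀ e ∈ N.graph.edgeSet, N.R e = 0)
    (hs : s ∉ N.exceptionalSet) : DifferentiableAt ℂ (N.limitAdmittance a B) s := by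
  have hsec := N.isSectorial hR hs
  obtain ⟨c, hc, hcoer⟩ := hsec.coercive N.relInductance_bounded
    (N.ne_zero_of_notMem_exceptionalSet hs)
  have h1 := hsec.differentiableAt N.relInductance_bounded
  have h2 := differentiableAt_galerkinSolution (g := N.nodeVector a)
    (⨆ n, N.innerSpace a B n).topologicalClosure h1 hc hcoer
  have h3 := h1.clm_apply ((differentiableAt_const (N.nodeVector a)).add h2)
  exact ((innerSL ℂ (N.nodeVector a)).differentiableAt.comp s h3).const_mul 2⁻¹

end InfiniteNetwork

end RLCGraph

theorem mainTheorem2 {V : Type*} [Infinite V] (N : RLCGraph V)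
    (hconn : N.graph.Connected) (hfin : ∀ x, (N.graph.neighborSet x).Finite)
    (a : V) (B : Set V) (ha : a ∉ B)
    (hR : ∀ e ∈ N.graph.edgeSet, N.R e = 0) :
    ∃ P : ℂ → ℂ,
      (IsOpen (N.exceptionalSet)ᶜ ∧
        (∀ s ∈ (N.exceptionalSet)ᶜ, N.HasEffAdmittance a B s (P s)) ∧
        DifferentiableOn ℂ P (N.exceptionalSet)ᶜ) ∧
      (IsOpen (RLCGraph.imInterval (-RLCGraph.sqrtE N.supCL) (RLCGraph.sqrtE N.supCL))ᶜ ∧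
        (∀ s ∈ (RLCGraph.imInterval (-RLCGraph.sqrtE N.supCL) (RLCGraph.sqrtE N.supCL))ᶜ,
          N.HasEffAdmittance a B s (P s)) ∧
        DifferentiableOn ℂ P
          (RLCGraph.imInterval (-RLCGraph.sqrtE N.supCL) (RLCGraph.sqrtE N.supCL))ᶜ) := by
  let _ : N.graph.LocallyFinite := fun x => (hfin x).fintype
  have hsub := Set.compl_subset_compl.2 (N.exceptionalSet_subset hR)
  have hlim : ∀ s ∈ (N.exceptionalSet)ᶜ, N.HasEffAdmittance a B s (N.limitAdmittance a B s) :=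
    fun s hs => RLCGraph.hasEffAdmittance_limitAdmittance hconn hfin ha hR hs
  have hdiff : DifferentiableOn ℂ (N.limitAdmittance a B) (N.exceptionalSet)ᶜ := fun s hs =>
    (RLCGraph.differentiableAt_limitAdmittance hR hs).differentiableWithinAt
  exact ⟨N.limitAdmittance a B,
    ⟨N.isClosed_exceptionalSet.isOpen_compl, hlim, hdiff⟩,
    ⟨(RLCGraph.isClosed_imInterval _ _).isOpen_compl, fun s hs => hlim s (hsub hs),
      hdiff.mono hsub⟩⟩
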